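/- **Theorem 1.2.** Let $\langle f_n\rangle_{n\ge 0}$ be a sequence of real polynomials that converges weakly to a formal power series $f$; that is, for every integer $k\ge 0$ the sequence $\langle f_n^{(k)}(0)\rangle$ converges, and the $k$-th coefficient of $f$ is $\frac{1}{k!}\lim_{n\to\infty} f_n^{(k)}(0)$. Suppose that some coefficient of $f$ is not $0$. Let $N(f_n;\mathbb C\setminus\mathbb R)$ denote the number of non-real zeros of $f_n$, counted with multiplicity (and taken to be $0$ if $f_n$ is identically zero), and suppose that the sequence $\langle N(f_n;\mathbb C\setminus\mathbb R)\rangle$ is bounded. Then the series $f$ has infinite radius of convergence, its sum is an entire function in the class $\mathcal{LP}^*$, and $f_n\to f$ uniformly on compact sets in the complex plane. Here the Laguerre–Pólya class $\mathcal{LP}$ consists of the functions of the form $$g(z)=c\,z^m e^{-\alpha z^2+\beta z}\prod_j\Bigl(1-\frac{z}{a_j}\Bigr)e^{z/a_j}\qquad(z\in\mathbb C),$$ where $c,\beta\in\mathbb R$, $m$ is a nonnegative integer, $\alpha\ge 0$, and $(a_j)$ is a finite (possibly empty) or infinite sequence of nonzero real numbers with $\sum_j |a_j|^{-2}<\infty$.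 The class $\mathcal{LP}^*$ consists of the real entire functions (entire functions that map $\mathbb R$ into $\mathbb R$) of the form $Pg$, where $P$ is a real polynomial and $g\in\mathcal{LP}$. -/

import Mathlib

open Filter Topology
open scoped Polynomial Nat

noncomputable section

open scoped Classical in
/-- `N(p; X)`: the number of zeros of the complex polynomial `p` lying in `X`, counted with
multiplicity.  By convention it is `0` for the zero polynomial. -/
def zeroCount (p : ℂ[X]) (X : Set ℂ) : ℕ :=
  (p.roots.filter (fun z => z ∈ X)).card

/-- A sequence of polynomials converges weakly to the formal power series `s`: for every `k` the
sequence `(p n)^{(k)}(0)` converges, and the `k`-th coefficient of `s` is `1 / k!` times its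
limit. -/
def ConvergesWeakly (p : ℕ → ℂ[X]) (s : PowerSeries ℂ) : Prop :=
  ∀ k : ℕ, ∃ l : ℂ,
    Tendsto (fun n => (Polynomial.derivative^[k] (p n)).eval 0) atTop (𝓝 l) ∧
      PowerSeries.coeff k s = 1 / (k ! : ℂ) * l

/-- Strong convergence: uniform convergence on every compact subset of the plane. -/
def ConvergesStrongly (p : ℕ → ℂ[X]) (F : ℂ → ℂ) : Prop :=
  ∀ K : Set ℂ, IsCompact K → TendstoUniformlyOn (fun n z => (p n).eval z) F atTop K

/-- The formal power series `s` has infinite radius of convergence and its sum is `F`. -/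
def Represents (s : PowerSeries ℂ) (F : ℂ → ℂ) : Prop :=
  ∀ z : ℂ, HasSum (fun k : ℕ => PowerSeries.coeff k s * z ^ k) (F z)

/-- The Laguerre–Pólya class: functions of the form
`c z ^ m exp (-α z ^ 2 + β z) ∏ j, (1 - z / a j) exp (z / a j)`
with `c`, `β` real, `m` a natural number, `α ≥ 0`, and a finite (possibly empty) or infinite
sequence of nonzero reals `a j`, indexed by a set `J` of natural numbers, such that
`∑ j, |a j| ^ (-2) < ∞`. -/
def IsLaguerrePolya (g : ℂ → ℂ) : Prop :=
  ∃ (c : ℝ) (m : ℕ) (α β : ℝ) (J : Set ℕ) (a : J → ℝ),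
    0 ≤ α ∧ (∀ j, a j ≠ 0) ∧ Summable (fun j => (|a j| ^ 2)⁻¹) ∧
      ∀ z : ℂ,
        Multipliable (fun j => (1 - z / (a j : ℂ)) * Complex.exp (z / (a j : ℂ))) ∧
        g z = (c : ℂ) * z ^ m * Complex.exp (-(α : ℂ) * z ^ 2 + (β : ℂ) * z) *
          ∏' j, ((1 - z / (a j : ℂ)) * Complex.exp (z / (a j : ℂ)))

/-- A real entire function: entire, and real on the real axis. -/
def IsRealEntire (F : ℂ → ℂ) : Prop :=
  Differentiable ℂ F ∧ ∀ x : ℝ, (F (x : ℂ)).im = 0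

/-- Pólya's class `LP*`: real entire functions that are the product of a real polynomial and a
function in the Laguerre–Pólya class. -/
def IsLaguerrePolyaStar (F : ℂ → ℂ) : Prop :=
  IsRealEntire F ∧
    ∃ (P : ℝ[X]) (g : ℂ → ℂ), IsLaguerrePolya g ∧ ∀ z : ℂ, F z = Polynomial.aeval z P * g z

end

/-!
The proof rests on a uniform bound for the zeros of a real polynomial `p` with `p(0) = 1`, with
bounded coefficients and with at most `B` non-real zeros. By Newton's identities the power sums
`∑ z ^ (-m)` over all zeros are bounded. By simultaneous Dirichlet approximation some even `m`, not
larger than a constant depending on `B`, makes all the non-real terms `z ^ (-m)` point nearly in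
the positive direction. For this `m` no cancellation can occur in the power sum, so the
reciprocals of the non-real zeros are bounded, and hence so are `∑ x` and `∑ x ^ 2` over the
reciprocals `x` of the real zeros. This is `exists_uniform_factorization`.

The bound is used twice. Let `K` be the index of a nonzero coefficient of the limit. By Rolle's
theorem the derivatives of order `K` of the given polynomials have at most as many non-real zeros,
and their values at `0` have a nonzero limit. So they are locally bounded in the plane, and Cauchy's
estimate gives coefficient bounds for the polynomials themselves (`exists_coeff_bound`), whence
uniform convergence on compact sets to an entire function `F`.

For the shape of `F` the polynomials are recentred at a real point `t` with `F t ≠ 0`, which keeps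
their zeros away from the centre. Ordering the real reciprocal zeros by decreasing absolute value
gives `|x i| ≤ sqrt (S / (i + 1))`. After passing to a subsequence along which everything converges
(including the polynomial carrying the non-real zeros), the genus two products converge by dominated
convergence. The sum of squares may drop in the limit, and this defect produces the Gaussian factor
with `α ≥ 0` (`exists_product_form_of_tendsto`). Finally the product is translated back to the
origin (`exists_translate_genus_one`).
-/

/-! ### Reciprocal zeros, power sums and factorization -/

/-- The polynomial `∏ (1 - w X)` over the elements `w` of a multiset: the polynomial with value
`1` at the origin whose reciprocal zeros are the nonzero elements of the multiset. -/
noncomputable def recipProd {R : Type*} [CommRing R] (u : Multiset R) : R[X] :=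
  (u.map fun w => 1 - Polynomial.C w * Polynomial.X).prod

section recipProd

variable {R : Type*} [CommRing R]

@[simp] lemma recipProd_zero : recipProd (0 : Multiset R) = 1 := by simp [recipProd]

lemma recipProd_cons (w : R) (u : Multiset R) :
    recipProd (w ::ₘ u) = (1 - Polynomial.C w * Polynomial.X) * recipProd u := by
  simp [recipProd]

lemma recipProd_add (u v : Multiset R) : recipProd (u + v) = recipProd u * recipProd v := by
  simp [recipProd]

lemma recipProd_map {S : Type*} [CommRing S] (g : R →+* S) (u : Multiset R) :
    (recipProd u).map g = recipProd (u.map g) := by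
  simp [recipProd, Polynomial.map_multiset_prod, Multiset.map_map]

lemma coeff_zero_recipProd (u : Multiset R) : (recipProd u).coeff 0 = 1 := by
  induction u using Multiset.induction with
  | empty => simp
  | cons w u ih => simp [recipProd_cons, Polynomial.mul_coeff_zero, ih]

/-- Newton's identities in the form `P' = -P T`, where `T` is the generating function of the
power sums of the reciprocal zeros. -/
lemma derivative_recipProd (u : Multiset R) :
    PowerSeries.derivative R (recipProd u : PowerSeries R) =
      -((recipProd u : PowerSeries R) *
        PowerSeries.mk fun m => (u.map fun w => w ^ (m + 1)).sum) := by
  induction u using Multiset.induction with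
  | empty =>
    ext m
    simp
  | cons w u ih =>
    have key : (1 - PowerSeries.C w * PowerSeries.X) * PowerSeries.mk (fun m => w ^ (m + 1)) =
        PowerSeries.C w := by
      ext m
      rcases m with _ | m
      · simp [sub_mul, mul_assoc]
      · simp [sub_mul, mul_assoc, PowerSeries.coeff_succ_X_mul, pow_succ']
    have hT : (PowerSeries.mk fun m => ((w ::ₘ u).map fun w => w ^ (m + 1)).sum) =
        PowerSeries.mk (fun m => w ^ (m + 1)) +
          PowerSeries.mk fun m => (u.map fun w => w ^ (m + 1)).sum := by
      ext m; simp
    rw [hT, recipProd_cons]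
    push_cast
    rw [Derivation.leibniz, ih]
    simp only [smul_eq_mul, map_sub, Derivation.leibniz, PowerSeries.derivative_C,
      PowerSeries.derivative_X, Derivation.map_one_eq_zero]
    linear_combination (recipProd u : PowerSeries R) * key

end recipProd

/-- Newton's identities bound each power sum of the reciprocal zeros in terms of the
coefficients of the polynomial, independently of the number of zeros. -/
lemma exists_powerSum_bound (A : ℕ → ℝ) (n : ℕ) :
    ∃ C : ℝ, ∀ u : Multiset ℂ, (∀ k, ‖(recipProd u).coeff k‖ ≤ A k) →
      ‖(u.map fun w => w ^ (n + 1)).sum‖ ≤ C := by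
  induction n using Nat.strong_induction_on with
  | _ n ih =>
    have ih' : ∀ j : ℕ, ∃ C : ℝ, j < n → ∀ u : Multiset ℂ,
        (∀ k, ‖(recipProd u).coeff k‖ ≤ A k) → ‖(u.map fun w => w ^ (j + 1)).sum‖ ≤ C := by
      intro j
      by_cases hj : j < n
      · obtain ⟨C, hC⟩ := ih j hj
        exact ⟨C, fun _ => hC⟩
      · exact ⟨0, fun h => absurd h hj⟩
    choose C hC using ih'
    refine ⟨A (n + 1) * (n + 1) + ∑ i ∈ Finset.range n, A (i + 1) * C (n - (i + 1)), ?_⟩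
    intro u hu
    have h := congrArg (PowerSeries.coeff n) (derivative_recipProd u)
    rw [PowerSeries.coeff_derivative, map_neg, PowerSeries.coeff_mul,
      Finset.Nat.sum_antidiagonal_eq_sum_range_succ_mk, Finset.sum_range_succ'] at h
    simp only [Polynomial.coeff_coe, PowerSeries.coeff_mk, coeff_zero_recipProd, one_mul,
      Nat.sub_zero] at h
    have h2 : (u.map fun w => w ^ (n + 1)).sum = -((recipProd u).coeff (n + 1) * ((n : ℂ) + 1)) -
        ∑ i ∈ Finset.range n, (recipProd u).coeff (i + 1) *
          (u.map fun w => w ^ (n - (i + 1) + 1)).sum := by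
      linear_combination h
    rw [h2]
    refine (norm_sub_le _ _).trans (add_le_add ?_ ?_)
    · have h3 : ‖((n : ℂ) + 1)‖ = (n : ℝ) + 1 := by
        exact_mod_cast Complex.norm_natCast (n + 1)
      rw [norm_neg, norm_mul, h3]
      exact mul_le_mul_of_nonneg_right (hu _) (by positivity)
    · refine (norm_sum_le _ _).trans (Finset.sum_le_sum fun i hi => ?_)
      rw [norm_mul]
      have hi' := Finset.mem_range.1 hi
      exact mul_le_mul (hu _) (hC _ (by omega) u hu) (norm_nonneg _)
        ((norm_nonneg _).trans (hu (i + 1)))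

/-- Simultaneous Dirichlet approximation: finitely many points of the unit circle have a common
power, of bounded exponent, that moves all of them close to `1`. -/
lemma exists_pow_re_ge (B : ℕ) : ∃ M : ℕ, ∀ u : Fin B → ℂ, (∀ j, ‖u j‖ = 1) →
    ∃ m, 1 ≤ m ∧ m ≤ M ∧ ∀ j, 1 / 2 ≤ ((u j) ^ m).re := by
  obtain ⟨t, -, htf, ht⟩ := (isCompact_closedBall (0 : Fin B → ℂ) 1).finite_cover_balls
    (show (0 : ℝ) < 1 / 4 by norm_num)
  refine ⟨htf.toFinset.card, fun u hu => ?_⟩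
  have hmem : ∀ i : ℕ, ∃ y ∈ t, dist (u ^ i) y < 1 / 4 := by
    intro i
    have h1 : u ^ i ∈ Metric.closedBall (0 : Fin B → ℂ) 1 := by
      rw [mem_closedBall_zero_iff, pi_norm_le_iff_of_nonneg zero_le_one]
      intro j
      simp [hu j]
    simpa using ht h1
  choose y hyt hy using hmem
  obtain ⟨i, hi, j, hj, hij, he⟩ := Finset.exists_ne_map_eq_of_card_lt_of_maps_to
    (s := Finset.range (htf.toFinset.card + 1)) (t := htf.toFinset) (f := y) (by simp)
    (fun i _ => by simpa using hyt i)
  wlog hlt : i < j generalizing i j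
  · exact this j hj i hi hij.symm he.symm (by omega)
  refine ⟨j - i, by omega, by simp at hj; omega, fun k => ?_⟩
  have h1 : dist (u ^ i) (u ^ j) < 1 / 2 := by
    have := dist_triangle_right (u ^ i) (u ^ j) (y i)
    have h2 := hy i
    have h3 := hy j
    rw [← he] at h3
    linarith
  have h2 : ‖1 - u k ^ (j - i)‖ < 1 / 2 := by
    have h3 : ‖(u ^ i - u ^ j) k‖ ≤ ‖u ^ i - u ^ j‖ := norm_le_pi_norm _ k
    have h4 : (u ^ i - u ^ j) k = u k ^ i * (1 - u k ^ (j - i)) := by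
      simp only [Pi.sub_apply, Pi.pow_apply]
      rw [mul_sub, mul_one, ← pow_add]
      congr 2; omega
    rw [h4, norm_mul, norm_pow, hu, one_pow, one_mul] at h3
    rw [dist_eq_norm] at h1
    linarith
  have h3 := (Complex.re_le_norm (1 - u k ^ (j - i)))
  simp only [Complex.sub_re, Complex.one_re] at h3
  linarith

lemma exists_pow_re_ge_norm (B : ℕ) : ∃ M : ℕ, ∀ u : Multiset ℂ, u.card ≤ B →
    ∃ m, 1 ≤ m ∧ m ≤ M ∧ ∀ w ∈ u, 1 / 2 * ‖w‖ ^ m ≤ (w ^ m).re := by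
  obtain ⟨M, hM⟩ := exists_pow_re_ge B
  refine ⟨M, fun u hu => ?_⟩
  let v : Fin B → ℂ := fun j => u.toList.getD j 0
  obtain ⟨m, h1, h2, h3⟩ := hM (fun j => if v j = 0 then 1 else v j / ‖v j‖) (fun j => by
    split_ifs with h
    · simp
    · simp [div_self (norm_ne_zero_iff.2 h)])
  refine ⟨m, h1, h2, fun w hw => ?_⟩
  obtain ⟨i, hi, hiw⟩ := List.mem_iff_getElem.1 (Multiset.mem_toList.2 hw)
  have hvi : v ⟨i, by rw [Multiset.length_toList] at hi; omega⟩ = w := by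
    change u.toList.getD i 0 = w
    rw [List.getD_eq_getElem _ _ hi, hiw]
  by_cases hw0 : w = 0
  · simp [hw0, zero_pow (by omega : m ≠ 0)]
  have h4 := h3 ⟨i, by rw [Multiset.length_toList] at hi; omega⟩
  rw [hvi, if_neg hw0, div_pow, ← Complex.ofReal_pow, Complex.div_ofReal_re] at h4
  have : 0 < ‖w‖ ^ m := by positivity
  rwa [le_div_iff₀ this] at h4

/-- A polynomial with constant term `1` splits into the factors `1 - x X` of its zeros in the
field and a factor without zeros there. -/
lemma exists_eq_mul_recipProd {k : Type*} [Field k] (p : k[X]) (hp : p.coeff 0 = 1) :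
    ∃ (q : k[X]) (u : Multiset k), p = q * recipProd u ∧ q.natDegree + p.roots.card = p.natDegree ∧
      u.card = p.roots.card ∧ q.coeff 0 = 1 := by
  obtain ⟨q, hq, hdeg, -⟩ := p.exists_prod_multiset_X_sub_C_mul
  have h0 : (0 : k) ∉ p.roots := by
    intro h
    have := Polynomial.isRoot_of_mem_roots h
    rw [Polynomial.IsRoot, ← Polynomial.coeff_zero_eq_eval_zero, hp] at this
    exact one_ne_zero this
  have key : ∀ u : Multiset k, (0 : k) ∉ u →
      (u.map fun a => Polynomial.X - Polynomial.C a).prod =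
        Polynomial.C (u.map fun a => -a).prod * recipProd (u.map fun a => a⁻¹) := by
    intro u
    induction u using Multiset.induction with
    | empty => simp
    | cons a u ih =>
      intro hu
      rw [Multiset.mem_cons, not_or] at hu
      have ha : a ≠ 0 := fun h => hu.1 h.symm
      simp only [Multiset.map_cons, Multiset.prod_cons, recipProd_cons, ih hu.2]
      have : Polynomial.C a * Polynomial.C a⁻¹ = 1 := by
        rw [← Polynomial.C_mul, mul_inv_cancel₀ ha, Polynomial.C_1]
      simp only [Polynomial.C_mul, Polynomial.C_neg]
      linear_combination (-(Polynomial.X * Polynomial.C (u.map fun a => -a).prod *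
        recipProd (u.map fun a => a⁻¹))) * this
  have hc : (p.roots.map fun a => -a).prod ≠ 0 := by
    refine Multiset.prod_ne_zero ?_
    simpa using h0
  have heq : p = (Polynomial.C (p.roots.map fun a => -a).prod * q) *
      recipProd (p.roots.map fun a => a⁻¹) := by
    conv_lhs => rw [← hq, key _ h0]
    ring
  refine ⟨_, _, heq, ?_, by simp, ?_⟩
  · rw [Polynomial.natDegree_C_mul hc]; omega
  · have := congrArg (Polynomial.coeff · 0) heq
    simp only [Polynomial.mul_coeff_zero, coeff_zero_recipProd, hp, mul_one] at this
    rw [Polynomial.mul_coeff_zero, ← this]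

lemma exists_eq_recipProd (p : ℂ[X]) (hp : p.coeff 0 = 1) :
    ∃ u : Multiset ℂ, p = recipProd u ∧ u.card = p.natDegree := by
  obtain ⟨q, u, h1, h2, h3, h4⟩ := exists_eq_mul_recipProd p hp
  have hcard : p.roots.card = p.natDegree := (IsAlgClosed.splits p).natDegree_eq_card_roots.symm
  have hq : q = 1 := by
    rw [Polynomial.eq_C_of_natDegree_eq_zero (by omega : q.natDegree = 0), h4, Polynomial.C_1]
  exact ⟨u, by rw [h1, hq, one_mul], h3.trans hcard⟩

lemma norm_eval_recipProd_le (u : Multiset ℂ) {R : ℝ} (hu : ∀ w ∈ u, ‖w‖ ≤ R) (z : ℂ) :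
    ‖(recipProd u).eval z‖ ≤ (1 + R * ‖z‖) ^ u.card := by
  induction u using Multiset.induction with
  | empty => simp
  | cons w u ih =>
    have hw := hu w (Multiset.mem_cons_self w u)
    rw [recipProd_cons, Polynomial.eval_mul, norm_mul, Multiset.card_cons, pow_succ']
    refine mul_le_mul ?_ (ih fun v hv => hu v (Multiset.mem_cons_of_mem hv)) (norm_nonneg _) ?_
    · simp only [Polynomial.eval_sub, Polynomial.eval_one, Polynomial.eval_mul, Polynomial.eval_C,
        Polynomial.eval_X]
      refine (norm_sub_le _ _).trans ?_
      rw [norm_one, norm_mul]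
      gcongr
    · have := (norm_nonneg w).trans hw
      positivity

/-- A polynomial with only real zeros is controlled by the first two power sums of its reciprocal
zeros, because `|1 - u| ^ 2 ≤ exp (-2 Re u + |u| ^ 2)`. -/
lemma norm_eval_recipProd_ofReal_le (s : Multiset ℝ) (z : ℂ) :
    ‖((recipProd s).map (algebraMap ℝ ℂ)).eval z‖ ≤
      Real.exp (-z.re * s.sum + ‖z‖ ^ 2 * (s.map fun x => x ^ 2).sum / 2) := by
  induction s using Multiset.induction with
  | empty => simp
  | cons x s ih =>
    rw [recipProd_cons, Polynomial.map_mul, Polynomial.eval_mul, norm_mul, Multiset.map_cons,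
      Multiset.sum_cons, Multiset.sum_cons]
    have h1 : ‖(1 : ℂ) - x * z‖ ≤ Real.exp (-z.re * x + ‖z‖ ^ 2 * x ^ 2 / 2) := by
      refine abs_le_of_sq_le_sq' ?_ (Real.exp_pos _).le |>.2
      rw [← Real.exp_nat_mul]
      refine le_trans (le_of_eq ?_) (Real.add_one_le_exp _)
      rw [← Complex.normSq_eq_norm_sq, ← Complex.normSq_eq_norm_sq]
      simp [Complex.normSq_apply]
      ring
    have h2 : -z.re * (x + s.sum) + ‖z‖ ^ 2 * (x ^ 2 + (s.map fun x => x ^ 2).sum) / 2 =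
        (-z.re * x + ‖z‖ ^ 2 * x ^ 2 / 2) +
          (-z.re * s.sum + ‖z‖ ^ 2 * (s.map fun x => x ^ 2).sum / 2) := by ring
    rw [h2, Real.exp_add]
    refine mul_le_mul ?_ ih (norm_nonneg _) (Real.exp_pos _).le
    simpa using h1

/-! ### Uniform bounds for polynomials with few non-real zeros -/

/-- The decisive compactness statement. Let `p` have constant term `1`, coefficients dominated by
`A`, and at most `B` non-real zeros, with reciprocals `w`. A suitable exponent `m` makes
`Re w ^ (2 m) ≥ |w| ^ (2 m) / 2` for all these `w`, while the real zeros contribute nonnegatively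
to the `2 m`-th power sum. That sum being bounded, all `w` are bounded, and then so are the first
two power sums of the reciprocals of the real zeros. -/
theorem exists_uniform_factorization (B : ℕ) (A : ℕ → ℝ) :
    ∃ R S : ℝ, 0 ≤ R ∧ 0 ≤ S ∧ ∀ p : ℝ[X], p.coeff 0 = 1 → p.natDegree ≤ p.roots.card + B →
      (∀ k, |p.coeff k| ≤ A k) → ∃ (q : ℝ[X]) (s : Multiset ℝ), p = q * recipProd s ∧
        q.natDegree ≤ B ∧ (∀ z : ℂ, ‖(q.map (algebraMap ℝ ℂ)).eval z‖ ≤ (1 + R * ‖z‖) ^ B) ∧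
        |s.sum| ≤ S ∧ (s.map fun x => x ^ 2).sum ≤ S := by
  choose C hC using exists_powerSum_bound A
  obtain ⟨M, hM⟩ := exists_pow_re_ge_norm B
  -- `D` bounds the power sums of the exponents `1`, `2` and `2 * m` with `1 ≤ m ≤ M`.
  let D : ℝ := ∑ n ∈ Finset.range (2 * M + 2), |C n|
  have hD0 : 0 ≤ D := Finset.sum_nonneg fun _ _ => abs_nonneg _
  have hCD : ∀ n, n < 2 * M + 2 → C n ≤ D := fun n hn =>
    (le_abs_self _).trans (Finset.single_le_sum (f := fun n => |C n|) (fun _ _ => abs_nonneg _)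
      (Finset.mem_range.2 hn))
  let R : ℝ := 1 + 2 * D
  have hR : 1 ≤ R := by simp only [R]; linarith
  have hR0 : 0 ≤ R := by linarith
  refine ⟨R, D + B * R ^ 2, hR0, by positivity, fun p hp0 hdeg hA => ?_⟩
  obtain ⟨q, s, hps, hqdeg, hscard, hq0⟩ := exists_eq_mul_recipProd p hp0
  have hqB : q.natDegree ≤ B := by omega
  obtain ⟨t, hqt, htcard⟩ := exists_eq_recipProd (q.map (algebraMap ℝ ℂ)) (by simp [hq0])
  rw [Polynomial.natDegree_map] at htcard
  have hpu : p.map (algebraMap ℝ ℂ) = recipProd (t + s.map (algebraMap ℝ ℂ)) := by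
    rw [hps, Polynomial.map_mul, hqt, recipProd_map, recipProd_add]
  have hcoef : ∀ k, ‖(recipProd (t + s.map (algebraMap ℝ ℂ))).coeff k‖ ≤ A k := by
    intro k
    rw [← hpu, Polynomial.coeff_map]
    simpa using hA k
  have hpow : ∀ n, n < 2 * M + 2 →
      ‖(t.map fun w => w ^ (n + 1)).sum + ((s.map fun x => x ^ (n + 1)).sum : ℝ)‖ ≤ D := by
    intro n hn
    have h := (hC n _ hcoef).trans (hCD n hn)
    have h2 : ((s.map fun x => x ^ (n + 1)).sum : ℝ) =
        ((s.map (algebraMap ℝ ℂ)).map fun w => w ^ (n + 1)).sum := by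
      rw [← Complex.coe_algebraMap, map_multiset_sum]
      simp [Multiset.map_map]
    rw [h2, ← Multiset.sum_add, ← Multiset.map_add]
    exact h
  have hR_of_mem : ∀ w ∈ t, ‖w‖ ≤ R := by
    obtain ⟨m, hm1, hmM, hm⟩ := hM (t.map fun w => w ^ 2) (by simpa [htcard] using hqB)
    have hm' : ∀ w ∈ t, 1 / 2 * ‖w‖ ^ (2 * m) ≤ (w ^ (2 * m)).re := by
      intro w hw
      have := hm (w ^ 2) (Multiset.mem_map_of_mem _ hw)
      rwa [norm_pow, ← pow_mul, ← pow_mul] at this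
    have h1 := hpow (2 * m - 1) (by omega)
    rw [show 2 * m - 1 + 1 = 2 * m by omega] at h1
    have h2 := (Complex.re_le_norm _).trans h1
    rw [Complex.add_re, Complex.ofReal_re] at h2
    have h3 : 0 ≤ (s.map fun x => x ^ (2 * m)).sum := by
      refine Multiset.sum_nonneg fun y hy => ?_
      obtain ⟨x, -, rfl⟩ := Multiset.mem_map.1 hy
      exact (even_two_mul m).pow_nonneg x
    have h4 : (t.map fun w => w ^ (2 * m)).sum.re = (t.map fun w => (w ^ (2 * m)).re).sum := by
      exact (map_multiset_sum Complex.reCLM _).trans (by rw [Multiset.map_map]; rfl)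
    intro w hw
    have h5 : (w ^ (2 * m)).re ≤ (t.map fun w => (w ^ (2 * m)).re).sum := by
      refine Multiset.single_le_sum (fun y hy => ?_) _ (Multiset.mem_map_of_mem _ hw)
      obtain ⟨v, hv, rfl⟩ := Multiset.mem_map.1 hy
      exact le_trans (by positivity) (hm' v hv)
    have h6 := hm' w hw
    by_contra hlt
    push Not at hlt
    have h7 : ‖w‖ ≤ ‖w‖ ^ (2 * m) := le_self_pow₀ (hR.trans hlt.le) (by omega)
    simp only [R] at hlt
    linarith
  have hbound : ∀ n, ‖(t.map fun w => w ^ (n + 1)).sum‖ ≤ B * R ^ (n + 1) := by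
    intro n
    have h1 : ((t.map fun w => w ^ (n + 1)).map norm).sum ≤ t.card • R ^ (n + 1) := by
      have := Multiset.sum_le_card_nsmul ((t.map fun w => w ^ (n + 1)).map norm) (R ^ (n + 1)) ?_
      · simpa using this
      · intro x hx
        simp only [Multiset.mem_map, exists_exists_and_eq_and] at hx
        obtain ⟨w, hw, rfl⟩ := hx
        rw [norm_pow]
        exact pow_le_pow_left₀ (norm_nonneg _) (hR_of_mem w hw) _
    refine (norm_multiset_sum_le _).trans (h1.trans ?_)
    rw [nsmul_eq_mul]
    gcongr
    omega
  have hsum : ∀ n, n < 2 * M + 2 → |(s.map fun x => x ^ (n + 1)).sum| ≤ D + B * R ^ (n + 1) := by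
    intro n hn
    have h1 := norm_sub_le ((t.map fun w => w ^ (n + 1)).sum +
      ((s.map fun x => x ^ (n + 1)).sum : ℝ)) (t.map fun w => w ^ (n + 1)).sum
    rw [add_sub_cancel_left, Complex.norm_real, Real.norm_eq_abs] at h1
    linarith [hpow n hn, hbound n]
  refine ⟨q, s, hps, hqB, fun z => ?_, ?_, ?_⟩
  · rw [hqt]
    refine (norm_eval_recipProd_le t hR_of_mem z).trans ?_
    refine pow_le_pow_right₀ ?_ (by omega)
    have : 0 ≤ R * ‖z‖ := by positivity
    linarith
  · have h1 := hsum 0 (by omega)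
    simp only [zero_add, pow_one, Multiset.map_id'] at h1
    refine h1.trans ?_
    have : R ≤ R ^ 2 := le_self_pow₀ hR two_ne_zero
    gcongr
  · exact (le_abs_self _).trans (hsum 1 (by omega))

/-- Cauchy's estimate for the coefficients of a polynomial. -/
lemma norm_coeff_le_of_forall_norm_eval_le (p : ℂ[X]) {r C : ℝ} (hr : 0 < r)
    (h : ∀ z : ℂ, ‖z‖ = r → ‖p.eval z‖ ≤ C) (k : ℕ) : ‖p.coeff k‖ ≤ C / r ^ k := by
  have hiter : ∀ k, iteratedDeriv k (fun z => p.eval z) =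
      fun z => (Polynomial.derivative^[k] p).eval z := by
    intro k
    induction k with
    | zero => simp
    | succ k ih =>
      rw [iteratedDeriv_succ, ih, Function.iterate_succ_apply']
      ext z
      exact Polynomial.deriv _
  have h1 := Complex.norm_iteratedDeriv_le_of_forall_mem_sphere_norm_le (c := 0) k hr
    (f := fun z => p.eval z) p.differentiable.diffContOnCl (fun z hz => h z (by simpa using hz))
  rw [hiter] at h1
  beta_reduce at h1
  rw [← Polynomial.coeff_zero_eq_eval_zero, Polynomial.coeff_iterate_derivative, zero_add,
    Nat.descFactorial_self, nsmul_eq_mul, norm_mul, Complex.norm_natCast, mul_div_assoc] at h1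
  exact le_of_mul_le_mul_left h1 (by positivity)

open scoped Classical in
/-- Having at most `B` non-real zeros, expressed through the real zeros alone: this form is
convenient under differentiation and translation. -/
lemma natDegree_le_card_roots_add {p : ℝ[X]} {B : ℕ}
    (h : zeroCount (p.map (algebraMap ℝ ℂ)) {z : ℂ | z.im ≠ 0} ≤ B) :
    p.natDegree ≤ p.roots.card + B := by
  rcases eq_or_ne p 0 with rfl | hp
  · simp
  obtain ⟨q, hq, hdeg, hroots⟩ := p.exists_prod_multiset_X_sub_C_mul
  have hq0 : q ≠ 0 := by
    rintro rfl
    exact hp (by rw [← hq, mul_zero])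
  have hle : q.map (algebraMap ℝ ℂ) ∣ p.map (algebraMap ℝ ℂ) :=
    Polynomial.map_dvd _ (Dvd.intro_left _ hq)
  have hp' : p.map (algebraMap ℝ ℂ) ≠ 0 :=
    (Polynomial.map_ne_zero_iff (algebraMap ℝ ℂ).injective).2 hp
  have h1 := Multiset.card_le_card (Multiset.filter_le_filter (fun z : ℂ => z ∈ {z : ℂ | z.im ≠ 0})
    (Polynomial.roots.le_of_dvd hp' hle))
  have h2 : (q.map (algebraMap ℝ ℂ)).roots.filter (fun z : ℂ => z ∈ {z : ℂ | z.im ≠ 0}) =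
      (q.map (algebraMap ℝ ℂ)).roots := by
    refine Multiset.filter_eq_self.2 fun z hz him => ?_
    have hz' := Polynomial.isRoot_of_mem_roots hz
    have hzr : z = algebraMap ℝ ℂ z.re := Complex.ext (by simp) (by simpa using him)
    rw [hzr] at hz'
    have : z.re ∈ q.roots :=
      (Polynomial.mem_roots hq0).2 ((Polynomial.isRoot_map_iff (algebraMap ℝ ℂ).injective).1 hz')
    simp [hroots] at this
  have h3 : (q.map (algebraMap ℝ ℂ)).roots.card = q.natDegree := by
    rw [← (IsAlgClosed.splits _).natDegree_eq_card_roots, Polynomial.natDegree_map]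
  rw [h2, h3] at h1
  have h4 : q.natDegree ≤ B := by
    refine h1.trans (le_trans (le_of_eq ?_) h)
    unfold zeroCount
    congr!
  omega

/-- By Rolle's theorem differentiation does not increase the number of non-real zeros. -/
lemma natDegree_iterate_derivative_le {p : ℝ[X]} {B : ℕ} (h : p.natDegree ≤ p.roots.card + B)
    (k : ℕ) : (Polynomial.derivative^[k] p).natDegree ≤
      (Polynomial.derivative^[k] p).roots.card + B := by
  induction k with
  | zero => exact h
  | succ k ih =>
    rw [Function.iterate_succ_apply']
    have h1 := Polynomial.card_roots_le_derivative (Polynomial.derivative^[k] p)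
    have h2 := Polynomial.natDegree_derivative_le (Polynomial.derivative^[k] p)
    rcases Nat.eq_zero_or_pos (Polynomial.derivative^[k] p).natDegree with h3 | h3 <;> omega

lemma natDegree_taylor_le {p : ℝ[X]} {B : ℕ} (h : p.natDegree ≤ p.roots.card + B) (x : ℝ) :
    (Polynomial.taylor x p).natDegree ≤ (Polynomial.taylor x p).roots.card + B := by
  have h1 := congrArg Multiset.card (p.map_roots_comp_C_mul_X_add_C 1 x isUnit_one)
  rw [Multiset.card_map, Polynomial.C_1, one_mul, ← Polynomial.taylor_apply] at h1
  rwa [Polynomial.natDegree_taylor, h1]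

/-- Sequence form of the uniform factorization: only the limit of the constant terms has to be
nonzero. -/
lemma exists_factorization_of_tendsto {f : ℕ → ℝ[X]} {a : ℕ → ℝ}
    (hconv : ∀ k, Tendsto (fun n => (f n).coeff k) atTop (𝓝 (a k))) (ha : a 0 ≠ 0) {B : ℕ}
    (hB : ∀ n, (f n).natDegree ≤ (f n).roots.card + B) :
    ∃ R S : ℝ, 0 ≤ R ∧ 0 ≤ S ∧ ∀ᶠ n in atTop, ∃ (q : ℝ[X]) (s : Multiset ℝ),
      f n = Polynomial.C ((f n).coeff 0) * (q * recipProd s) ∧ q.natDegree ≤ B ∧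
      (∀ z : ℂ, ‖(q.map (algebraMap ℝ ℂ)).eval z‖ ≤ (1 + R * ‖z‖) ^ B) ∧
      |s.sum| ≤ S ∧ (s.map fun x => x ^ 2).sum ≤ S := by
  obtain ⟨N, hN⟩ := eventually_atTop.1 ((hconv 0).eventually_ne ha)
  have hbd : ∀ k, ∃ A, ∀ n, |((f (n + N)).coeff 0)⁻¹ * (f (n + N)).coeff k| ≤ A := by
    intro k
    have h1 := ((((hconv 0).inv₀ ha).mul (hconv k)).comp (tendsto_add_atTop_nat N)).abs
    obtain ⟨A, hA⟩ := h1.bddAbove_range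
    exact ⟨A, fun n => hA ⟨n, rfl⟩⟩
  choose A hA using hbd
  obtain ⟨R, S, hR, hS, h⟩ := exists_uniform_factorization B A
  refine ⟨R, S, hR, hS, eventually_atTop.2 ⟨N, fun n hn => ?_⟩⟩
  obtain ⟨m, rfl⟩ : ∃ m, n = m + N := ⟨n - N, by omega⟩
  have h0 := hN (m + N) hn
  obtain ⟨q, s, hqs, hrest⟩ := h (Polynomial.C ((f (m + N)).coeff 0)⁻¹ * f (m + N))
    (by rw [Polynomial.coeff_C_mul, inv_mul_cancel₀ h0])
    (by rw [Polynomial.natDegree_C_mul (inv_ne_zero h0), Polynomial.roots_C_mul _ (inv_ne_zero h0)]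
        exact hB _)
    (fun k => by rw [Polynomial.coeff_C_mul]; exact hA k m)
  refine ⟨q, s, ?_, hrest⟩
  rw [← hqs, ← mul_assoc, ← Polynomial.C_mul, mul_inv_cancel₀ h0, Polynomial.C_1, one_mul]

lemma exists_coeff_bound_of_coeff_zero {f : ℕ → ℝ[X]} {a : ℕ → ℝ}
    (hconv : ∀ k, Tendsto (fun n => (f n).coeff k) atTop (𝓝 (a k))) (ha : a 0 ≠ 0) {B : ℕ}
    (hB : ∀ n, (f n).natDegree ≤ (f n).roots.card + B) {r : ℝ} (hr : 0 < r) :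
    ∃ C, ∀ᶠ n in atTop, ∀ k, |(f n).coeff k| ≤ C / r ^ k := by
  obtain ⟨R, S, hR, hS, h⟩ := exists_factorization_of_tendsto hconv ha hB
  obtain ⟨D, hD⟩ := (hconv 0).abs.bddAbove_range
  have hD' : ∀ n, |(f n).coeff 0| ≤ D := fun n => hD ⟨n, rfl⟩
  refine ⟨D * ((1 + R * r) ^ B * Real.exp (r * S + r ^ 2 * S / 2)), h.mono fun n hn k => ?_⟩
  obtain ⟨q, s, hf, -, hq, hs1, hs2⟩ := hn
  have hk : |(f n).coeff k| = ‖((f n).map (algebraMap ℝ ℂ)).coeff k‖ := by simp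
  rw [hk]
  refine norm_coeff_le_of_forall_norm_eval_le _ hr (fun z hz => ?_) k
  rw [hf]
  simp only [Polynomial.map_mul, Polynomial.eval_mul, Polynomial.map_C, Polynomial.eval_C, norm_mul]
  have hq' := hq z
  rw [hz] at hq'
  have hz1 : -z.re * s.sum ≤ r * S := by
    refine (le_abs_self _).trans ?_
    rw [abs_mul, abs_neg]
    exact mul_le_mul ((Complex.abs_re_le_norm z).trans hz.le) hs1 (abs_nonneg _) hr.le
  have hs' := norm_eval_recipProd_ofReal_le s z
  have hexp : Real.exp (-z.re * s.sum + ‖z‖ ^ 2 * (s.map fun x => x ^ 2).sum / 2) ≤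
      Real.exp (r * S + r ^ 2 * S / 2) := by
    rw [hz]
    gcongr
  have h0 : ‖algebraMap ℝ ℂ ((f n).coeff 0)‖ ≤ D := by simpa using hD' n
  exact mul_le_mul h0 (mul_le_mul hq' (hs'.trans hexp) (norm_nonneg _) (by positivity))
    (by positivity) ((norm_nonneg _).trans h0)

/-- The coefficients satisfy Cauchy estimates that are uniform in `n`, on discs of every radius.
Passing to the derivative of order `K` makes the constant term of the limit nonzero. -/
lemma exists_coeff_bound {f : ℕ → ℝ[X]} {a : ℕ → ℝ}
    (hconv : ∀ k, Tendsto (fun n => (f n).coeff k) atTop (𝓝 (a k))) {K : ℕ} (ha : a K ≠ 0) {B : ℕ}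
    (hB : ∀ n, (f n).natDegree ≤ (f n).roots.card + B) {r : ℝ} (hr : 0 < r) :
    ∃ C, ∀ᶠ n in atTop, ∀ k, |(f n).coeff k| ≤ C / r ^ k := by
  obtain ⟨C, hC⟩ := exists_coeff_bound_of_coeff_zero
    (f := fun n => Polynomial.derivative^[K] (f n))
    (a := fun m => (m + K).descFactorial K • a (m + K))
    (fun m => by
      simp only [Polynomial.coeff_iterate_derivative]
      exact (hconv (m + K)).const_smul _)
    (by simpa [Nat.factorial_ne_zero] using ha)
    (fun n => natDegree_iterate_derivative_le (hB n) K) hr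
  have hD : ∀ k, ∃ D, ∀ n, |(f n).coeff k| ≤ D := fun k => by
    obtain ⟨D, hD⟩ := (hconv k).abs.bddAbove_range
    exact ⟨D, fun n => hD ⟨n, rfl⟩⟩
  choose D hD using hD
  have hD0 : ∀ k, 0 ≤ D k := fun k => (abs_nonneg _).trans (hD k 0)
  refine ⟨|C| * r ^ K + ∑ k ∈ Finset.range K, D k * r ^ k, hC.mono fun n hn k => ?_⟩
  have hs0 : 0 ≤ ∑ k ∈ Finset.range K, D k * r ^ k :=
    Finset.sum_nonneg fun k _ => mul_nonneg (hD0 k) (by positivity)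
  rw [le_div_iff₀ (by positivity)]
  rcases lt_or_ge k K with hk | hk
  · have h1 := Finset.single_le_sum (f := fun k => D k * r ^ k)
      (fun k _ => mul_nonneg (hD0 k) (by positivity)) (Finset.mem_range.2 hk)
    have h2 : |(f n).coeff k| * r ^ k ≤ D k * r ^ k := by
      gcongr
      exact hD k n
    have h3 : 0 ≤ |C| * r ^ K := by positivity
    linarith
  · obtain ⟨m, rfl⟩ : ∃ m, k = m + K := ⟨k - K, by omega⟩
    have h1 := hn m
    rw [Polynomial.coeff_iterate_derivative, nsmul_eq_mul, abs_mul, Nat.abs_cast,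
      le_div_iff₀ (by positivity)] at h1
    have h2 : (1 : ℝ) ≤ (m + K).descFactorial K := by
      exact_mod_cast Nat.succ_le_of_lt (Nat.descFactorial_pos.2 (by omega))
    have h3 : |(f n).coeff (m + K)| * r ^ m ≤ |C| := by
      refine le_trans ?_ (h1.trans (le_abs_self C))
      gcongr
      exact le_mul_of_one_le_left (abs_nonneg _) h2
    have h4 : |(f n).coeff (m + K)| * r ^ (m + K) ≤ |C| * r ^ K := by
      rw [pow_add, ← mul_assoc]
      gcongr
    linarith

/-! ### Coefficient bounds and locally uniform convergence -/

lemma hasSum_coeff_mul_pow {k : Type*} [CommSemiring k] [TopologicalSpace k] (p : k[X]) (x : k) :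
    HasSum (fun i => p.coeff i * x ^ i) (p.eval x) := by
  rw [Polynomial.eval_eq_sum_range]
  refine hasSum_sum_of_ne_finset_zero fun i hi => ?_
  rw [Polynomial.coeff_eq_zero_of_natDegree_lt (by simpa using hi), zero_mul]

section CoefficientBounds

variable {f : ℕ → ℝ[X]} {a : ℕ → ℝ}

lemma abs_le_of_tendsto_coeff (hconv : ∀ k, Tendsto (fun n => (f n).coeff k) atTop (𝓝 (a k)))
    {C r : ℝ} (hC : ∀ᶠ n in atTop, ∀ k, |(f n).coeff k| ≤ C / r ^ k) (k : ℕ) :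
    |a k| ≤ C / r ^ k :=
  le_of_tendsto (hconv k).abs (hC.mono fun _ h => h k)

lemma summable_of_coeff_bound (hconv : ∀ k, Tendsto (fun n => (f n).coeff k) atTop (𝓝 (a k)))
    (hC : ∀ r : ℝ, 0 < r → ∃ C, ∀ᶠ n in atTop, ∀ k, |(f n).coeff k| ≤ C / r ^ k) (z : ℂ) :
    Summable fun k => (a k : ℂ) * z ^ k := by
  obtain ⟨C, h⟩ := hC (2 * (1 + ‖z‖)) (by positivity)
  refine Summable.of_norm_bounded (g := fun k => C * (1 / 2) ^ k)
    (summable_geometric_two.mul_left C) fun k => ?_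
  have h1 := abs_le_of_tendsto_coeff hconv h k
  have h2 : ‖z‖ ^ k ≤ (1 + ‖z‖) ^ k := by gcongr; linarith
  rw [norm_mul, norm_pow, Complex.norm_real, Real.norm_eq_abs]
  have hpos : 0 < (1 + ‖z‖) ^ k := by positivity
  calc |a k| * ‖z‖ ^ k ≤ C / (2 * (1 + ‖z‖)) ^ k * (1 + ‖z‖) ^ k :=
        mul_le_mul h1 h2 (by positivity) ((abs_nonneg _).trans h1)
    _ = C * (1 / 2) ^ k := by
        rw [mul_pow, div_pow, one_pow]
        field_simp

/-- Convergence of the coefficients together with uniform Cauchy estimates gives uniform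
convergence on compact sets. -/
lemma convergesStrongly_of_coeff_bound
    (hconv : ∀ k, Tendsto (fun n => (f n).coeff k) atTop (𝓝 (a k)))
    (hC : ∀ r : ℝ, 0 < r → ∃ C, ∀ᶠ n in atTop, ∀ k, |(f n).coeff k| ≤ C / r ^ k) :
    ConvergesStrongly (fun n => (f n).map (algebraMap ℝ ℂ)) fun z => ∑' k, (a k : ℂ) * z ^ k := by
  intro K hK
  obtain ⟨ρ, hρ0, hρ⟩ := hK.isBounded.exists_pos_norm_le
  obtain ⟨C, h⟩ := hC (2 * ρ) (by positivity)
  have ha := abs_le_of_tendsto_coeff hconv h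
  have hdom : ∀ᶠ n in atTop, ∀ k, ‖|(f n).coeff k - a k| * ρ ^ k‖ ≤ 2 * C * (1 / 2) ^ k := by
    filter_upwards [h] with n hn k
    rw [Real.norm_of_nonneg (by positivity)]
    calc |(f n).coeff k - a k| * ρ ^ k ≤ (C / (2 * ρ) ^ k + C / (2 * ρ) ^ k) * ρ ^ k := by
          gcongr
          exact (abs_sub _ _).trans (add_le_add (hn k) (ha k))
      _ = 2 * C * (1 / 2) ^ k := by
          rw [mul_pow, div_pow, one_pow]
          field_simp
          ring
  have hsum : Summable fun k : ℕ => 2 * C * (1 / 2 : ℝ) ^ k := summable_geometric_two.mul_left _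
  have hlim := tendsto_tsum_of_dominated_convergence (𝓕 := atTop)
    (f := fun n k => |(f n).coeff k - a k| * ρ ^ k) (g := fun _ => 0) hsum (fun k => by
      have := (((hconv k).sub_const (a k)).abs.mul_const (ρ ^ k))
      simpa using this) hdom
  rw [tsum_zero] at hlim
  rw [Metric.tendstoUniformlyOn_iff]
  intro ε hε
  filter_upwards [hlim.eventually_lt_const hε, hdom] with n hn hdn z hz
  have h1 : Summable fun k => |(f n).coeff k - a k| * ρ ^ k := hsum.of_norm_bounded hdn
  have h2 := ((hasSum_coeff_mul_pow ((f n).map (algebraMap ℝ ℂ)) z).sub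
    (summable_of_coeff_bound hconv hC z).hasSum)
  rw [dist_comm, dist_eq_norm, ← h2.tsum_eq]
  refine lt_of_le_of_lt (tsum_of_norm_bounded h1.hasSum fun k => ?_) hn
  have h3 : ((f n).map (algebraMap ℝ ℂ)).coeff k * z ^ k - (a k : ℂ) * z ^ k =
      (((f n).coeff k - a k : ℝ) : ℂ) * z ^ k := by
    rw [Polynomial.coeff_map, Complex.coe_algebraMap]
    push_cast
    ring
  rw [h3, norm_mul, norm_pow, Complex.norm_real, Real.norm_eq_abs]
  gcongr
  exact hρ z hz

/-- Coefficient convergence with uniform Cauchy estimates persists after recentring at a real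
point. -/
lemma exists_tendsto_coeff_taylor
    (hconv : ∀ k, Tendsto (fun n => (f n).coeff k) atTop (𝓝 (a k)))
    (hC : ∀ r : ℝ, 0 < r → ∃ C, ∀ᶠ n in atTop, ∀ k, |(f n).coeff k| ≤ C / r ^ k) (x : ℝ) (m : ℕ) :
    Tendsto (fun n => (Polynomial.taylor x (f n)).coeff m) atTop
      (𝓝 (∑' k, ((k + m).choose m * a (k + m)) * x ^ k)) := by
  obtain ⟨C, h⟩ := hC (4 * (1 + |x|)) (by positivity)
  have h1 : ∀ n, (Polynomial.taylor x (f n)).coeff m =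
      ∑' k, ((k + m).choose m * (f n).coeff (k + m)) * x ^ k := by
    intro n
    rw [Polynomial.taylor_coeff, ← (hasSum_coeff_mul_pow _ x).tsum_eq]
    simp only [Polynomial.hasseDeriv_coeff]
  simp only [h1]
  refine tendsto_tsum_of_dominated_convergence (bound := fun k => C * (1 / 2) ^ k)
    (summable_geometric_two.mul_left _) (fun k => ((hconv _).const_mul _).mul_const _) ?_
  filter_upwards [h] with n hn k
  have h2 : (((k + m).choose m : ℕ) : ℝ) ≤ 2 ^ (k + m) := by
    exact_mod_cast Nat.choose_le_two_pow _ _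
  have h3 : |x| ^ k ≤ (1 + |x|) ^ (k + m) :=
    (pow_le_pow_left₀ (abs_nonneg x) (by linarith) k).trans
      (pow_le_pow_right₀ (by linarith [abs_nonneg x]) (by omega))
  have hC0 : 0 ≤ C := by simpa using (abs_nonneg _).trans (hn 0)
  have hpos : 0 < (1 + |x|) ^ (k + m) := by positivity
  rw [norm_mul, norm_mul, norm_pow, Real.norm_eq_abs, Real.norm_eq_abs, Real.norm_eq_abs,
    Nat.abs_cast]
  calc ((k + m).choose m : ℝ) * |(f n).coeff (k + m)| * |x| ^ k
      ≤ 2 ^ (k + m) * (C / (4 * (1 + |x|)) ^ (k + m)) * (1 + |x|) ^ (k + m) := by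
        gcongr
        exact hn _
    _ = C * (1 / 2) ^ (k + m) := by
        rw [mul_pow, show (4 : ℝ) ^ (k + m) = 2 ^ (k + m) * 2 ^ (k + m) by
          rw [← mul_pow]; norm_num, div_pow, one_pow]
        field_simp
    _ ≤ C * (1 / 2) ^ k :=
        mul_le_mul_of_nonneg_left (pow_le_pow_of_le_one (by norm_num) (by norm_num) (by omega)) hC0

end CoefficientBounds

/-- A power series with a nonzero coefficient has a real point at which its sum is not zero. -/
lemma exists_tsum_ne_zero {a : ℕ → ℝ} (hs : ∀ x : ℝ, Summable fun k => a k * x ^ k) {K : ℕ}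
    (hK : a K ≠ 0) : ∃ x : ℝ, ∑' k, a k * x ^ k ≠ 0 := by
  by_contra! h
  have h1 : HasFPowerSeriesAt (0 : ℝ → ℝ) (FormalMultilinearSeries.ofScalars ℝ a) 0 := by
    rw [hasFPowerSeriesAt_iff]
    refine Eventually.of_forall fun x => ?_
    have := (hs x).hasSum
    rw [h x] at this
    simpa [FormalMultilinearSeries.coeff_ofScalars, mul_comm] using this
  have h2 := congrArg (fun p => FormalMultilinearSeries.coeff p K) h1.eq_zero
  simp [FormalMultilinearSeries.coeff_ofScalars] at h2
  exact hK h2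

/-! ### Weierstrass factors and products over real zeros -/

/-- Estimate for the Weierstrass factor of genus one. -/
lemma norm_one_sub_mul_exp_sub_one_le (u : ℂ) :
    ‖(1 - u) * Complex.exp u - 1‖ ≤ ‖u‖ ^ 2 * Real.exp ‖u‖ := by
  have hd : ∀ v : ℂ, HasDerivAt (fun v => (1 - v) * Complex.exp v) (-v * Complex.exp v) v := by
    intro v
    refine (((hasDerivAt_id v).const_sub 1).mul (Complex.hasDerivAt_exp v)).congr_deriv ?_
    simp only [id]
    ring
  have h := (convex_closedBall (0 : ℂ) ‖u‖).norm_image_sub_le_of_norm_hasDerivWithin_le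
    (f := fun v => (1 - v) * Complex.exp v) (C := ‖u‖ * Real.exp ‖u‖) (x := 0) (y := u)
    (fun v _ => (hd v).hasDerivWithinAt) (fun v hv => by
      rw [mem_closedBall_zero_iff] at hv
      rw [norm_mul, norm_neg]
      gcongr
      exact (Complex.norm_exp_le_exp_norm v).trans (Real.exp_le_exp.2 hv)) (by simp) (by simp)
  simp only [sub_zero, Complex.exp_zero, mul_one] at h
  exact h.trans (le_of_eq (by ring))

/-- Estimate for the Weierstrass factor of genus two. -/
lemma norm_one_sub_mul_exp_add_sq_sub_one_le (u : ℂ) :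
    ‖(1 - u) * Complex.exp (u + u ^ 2 / 2) - 1‖ ≤
      ‖u‖ ^ 3 * Real.exp (‖u‖ + ‖u‖ ^ 2 / 2) := by
  have hd : ∀ v : ℂ, HasDerivAt (fun v => (1 - v) * Complex.exp (v + v ^ 2 / 2))
      (-v ^ 2 * Complex.exp (v + v ^ 2 / 2)) v := by
    intro v
    refine (((hasDerivAt_id v).const_sub 1).mul
      ((hasDerivAt_id v).add (((hasDerivAt_id v).pow 2).div_const 2)).cexp).congr_deriv ?_
    simp
    ring
  have h := (convex_closedBall (0 : ℂ) ‖u‖).norm_image_sub_le_of_norm_hasDerivWithin_le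
    (f := fun v => (1 - v) * Complex.exp (v + v ^ 2 / 2))
    (C := ‖u‖ ^ 2 * Real.exp (‖u‖ + ‖u‖ ^ 2 / 2)) (x := 0) (y := u)
    (fun v _ => (hd v).hasDerivWithinAt) (fun v hv => by
      rw [mem_closedBall_zero_iff] at hv
      rw [norm_mul, norm_neg, norm_pow]
      gcongr
      refine (Complex.norm_exp_le_exp_norm _).trans (Real.exp_le_exp.2 ?_)
      refine (norm_add_le _ _).trans ?_
      rw [norm_div, norm_pow, Complex.norm_two]
      gcongr) (by simp) (by simp)
  simp only [sub_zero, zero_pow two_ne_zero, zero_div, add_zero, Complex.exp_zero, mul_one] at h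
  exact h.trans (le_of_eq (by ring))

lemma exists_abs_le_of_summable_sq {x : ℕ → ℝ} (hx : Summable fun i => x i ^ 2) :
    ∃ D, ∀ i, |x i| ≤ D :=
  ⟨√(∑' i, x i ^ 2), fun i => Real.abs_le_sqrt (hx.le_tsum i fun _ _ => sq_nonneg _)⟩

lemma multipliable_genus_one {x : ℕ → ℝ} (hx : Summable fun i => x i ^ 2) (z : ℂ) :
    Multipliable fun i => (1 - x i * z) * Complex.exp (x i * z) := by
  obtain ⟨D, hD⟩ := exists_abs_le_of_summable_sq hx
  have h : Summable fun i => ‖(1 - x i * z) * Complex.exp (x i * z) - 1‖ := by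
    refine Summable.of_nonneg_of_le (fun _ => norm_nonneg _) (fun i => ?_)
      ((hx.mul_right (‖z‖ ^ 2)).mul_right (Real.exp (D * ‖z‖)))
    refine (norm_one_sub_mul_exp_sub_one_le _).trans ?_
    rw [norm_mul, Complex.norm_real, Real.norm_eq_abs, mul_pow, sq_abs]
    gcongr
    exact hD i
  simpa using multipliable_one_add_of_summable h

/-- Splitting off the quadratic exponents from a genus two product. -/
lemma tprod_genus_two {x : ℕ → ℝ} (hx : Summable fun i => x i ^ 2) (z : ℂ) :
    ∏' i, (1 - x i * z) * Complex.exp (x i * z + (x i * z) ^ 2 / 2) =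
      Complex.exp ((∑' i, x i ^ 2 : ℝ) / 2 * z ^ 2) *
        ∏' i, (1 - x i * z) * Complex.exp (x i * z) := by
  have h1 : HasSum (fun i => (x i * z) ^ 2 / 2) (((∑' i, x i ^ 2 : ℝ) : ℂ) / 2 * z ^ 2) := by
    have h := (Complex.hasSum_ofReal.2 hx.hasSum).mul_right (z ^ 2 / 2)
    have h' : (fun i => (x i * z) ^ 2 / 2) = fun i => ((x i ^ 2 : ℝ) : ℂ) * (z ^ 2 / 2) := by
      ext i
      push_cast
      ring
    rwa [h', div_mul_eq_mul_div, mul_div_assoc]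
  have h2 := h1.cexp.mul (multipliable_genus_one hx z).hasProd
  rw [← h2.tprod_eq]
  refine tprod_congr fun i => ?_
  simp only [Function.comp_apply, Complex.exp_add]
  ring

/-- Enumeration of a finite multiset of reals by decreasing absolute value, padded by zeros. -/
lemma exists_enumeration (s : Multiset ℝ) :
    ∃ x : ℕ → ℝ, s = (Multiset.range s.card).map x ∧ (∀ i, s.card ≤ i → x i = 0) ∧
      ∀ i, (i + 1) * x i ^ 2 ≤ (s.map fun y => y ^ 2).sum := by
  let l := s.toList.insertionSort fun a b => |b| ≤ |a|
  have : Std.Total fun a b : ℝ => |b| ≤ |a| := ⟨fun a b => le_total _ _⟩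
  have : IsTrans ℝ fun a b : ℝ => |b| ≤ |a| := ⟨fun a b c h1 h2 => h2.trans h1⟩
  have hl : l.Pairwise fun a b => |b| ≤ |a| := List.pairwise_insertionSort _ _
  have hls : (l : Multiset ℝ) = s := by
    rw [Multiset.coe_eq_coe.2 (List.perm_insertionSort _ _), Multiset.coe_toList]
  have hlen : l.length = s.card := by rw [← hls, Multiset.coe_card]
  have hs : s = (Multiset.range s.card).map fun i => l.getD i 0 := by
    rw [← hlen]
    conv_lhs => rw [← hls]
    rw [← Multiset.coe_range, Multiset.map_coe, Multiset.coe_eq_coe]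
    refine List.Perm.of_eq (List.ext_getElem (by simp) fun i h1 h2 => ?_)
    simp [List.getElem?_eq_getElem h1]
  have h0 : ∀ i, s.card ≤ i → l.getD i 0 = 0 := fun i hi =>
    List.getD_eq_default _ _ (by omega)
  refine ⟨_, hs, h0, fun i => ?_⟩
  have hsum : (s.map fun y => y ^ 2).sum = ∑ j ∈ Finset.range s.card, l.getD j 0 ^ 2 := by
    conv_lhs => rw [hs, Multiset.map_map]
    rfl
  rw [hsum]
  rcases lt_or_ge i s.card with hi | hi
  · have h1 : ∀ j ∈ Finset.range (i + 1), l.getD i 0 ^ 2 ≤ l.getD j 0 ^ 2 := by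
      intro j hj
      have hj' := Finset.mem_range.1 hj
      rw [sq_le_sq, List.getD_eq_getElem _ _ (by omega), List.getD_eq_getElem _ _ (by omega)]
      rcases Nat.lt_or_ge j i with hji | hji
      · exact List.pairwise_iff_getElem.1 hl _ _ _ _ hji
      · obtain rfl : j = i := by omega
        exact le_rfl
    calc ((i : ℝ) + 1) * l.getD i 0 ^ 2 = ∑ j ∈ Finset.range (i + 1), l.getD i 0 ^ 2 := by simp
      _ ≤ ∑ j ∈ Finset.range (i + 1), l.getD j 0 ^ 2 := Finset.sum_le_sum h1
      _ ≤ _ := Finset.sum_le_sum_of_subset_of_nonneg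
          (Finset.range_subset_range.2 (by omega)) fun _ _ _ => sq_nonneg _
  · rw [h0 i hi]
    simpa using Finset.sum_nonneg fun j _ => sq_nonneg (l.getD j 0)

/-- A polynomial with real zeros only, written as a genus two product. -/
lemma eval_recipProd_eq_tprod {s : Multiset ℝ} {x : ℕ → ℝ}
    (hs : s = (Multiset.range s.card).map x) (h0 : ∀ i, s.card ≤ i → x i = 0) (z : ℂ) :
    ((recipProd s).map (algebraMap ℝ ℂ)).eval z =
      Complex.exp (-s.sum * z - ((s.map fun y => y ^ 2).sum : ℝ) / 2 * z ^ 2) *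
        ∏' i, (1 - x i * z) * Complex.exp (x i * z + (x i * z) ^ 2 / 2) := by
  have h1 : ((recipProd s).map (algebraMap ℝ ℂ)).eval z =
      ∏ i ∈ Finset.range s.card, (1 - x i * z) := by
    rw [recipProd_map]
    conv_lhs => rw [hs]
    rw [recipProd, Multiset.map_map, Multiset.map_map, Polynomial.eval_multiset_prod,
      Multiset.map_map, Finset.prod_eq_multiset_prod]
    simp [Finset.range_val, Function.comp_def]
  have h2 : s.sum = ∑ i ∈ Finset.range s.card, x i := by
    conv_lhs => rw [hs]
    rfl
  have h3 : (s.map fun y => y ^ 2).sum = ∑ i ∈ Finset.range s.card, x i ^ 2 := by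
    conv_lhs => rw [hs, Multiset.map_map]
    rfl
  rw [tprod_eq_prod (s := Finset.range s.card) (fun i hi => by
    rw [h0 i (by simpa using hi)]; simp), Finset.prod_mul_distrib, ← Complex.exp_sum, h1, h2, h3]
  have h4 : ∑ i ∈ Finset.range s.card, ((x i : ℂ) * z + (x i * z) ^ 2 / 2) =
      -(-((∑ i ∈ Finset.range s.card, x i : ℝ) : ℂ) * z -
        ((∑ i ∈ Finset.range s.card, x i ^ 2 : ℝ) : ℂ) / 2 * z ^ 2) := by
    push_cast
    simp only [mul_pow, Finset.sum_add_distrib, ← Finset.sum_div, ← Finset.sum_mul]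
    ring
  rw [h4, mul_left_comm, ← Complex.exp_add, add_neg_cancel, Complex.exp_zero, mul_one]

/-! ### Passing to the limit and translating the centre -/

lemma eval_map_eq_sum_range {p : ℝ[X]} {B : ℕ} (h : p.natDegree ≤ B) (z : ℂ) :
    (p.map (algebraMap ℝ ℂ)).eval z = ∑ k ∈ Finset.range (B + 1), (p.coeff k : ℂ) * z ^ k := by
  rw [Polynomial.eval_eq_sum_range' (n := B + 1) (by rw [Polynomial.natDegree_map]; omega)]
  simp

/-- Continuity of genus two products under termwise limits of sequences dominated by
`sqrt (S / (i + 1))`: the sums of the third powers converge uniformly. -/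
lemma tendsto_tprod_genus_two {x : ℕ → ℕ → ℝ} {y : ℕ → ℝ} {S : ℝ}
    (hx : ∀ n i, |x n i| ≤ √(S / (i + 1)))
    (hlim : ∀ i, Tendsto (fun n => x n i) atTop (𝓝 (y i))) (z : ℂ) :
    Tendsto (fun n => ∏' i, (1 - x n i * z) * Complex.exp (x n i * z + (x n i * z) ^ 2 / 2)) atTop
      (𝓝 (∏' i, (1 - y i * z) * Complex.exp (y i * z + (y i * z) ^ 2 / 2))) := by
  have hsum : Summable fun i : ℕ => √(S / (i + 1)) ^ 3 := by
    have h1 : Summable fun i : ℕ => 1 / ((i + 1 : ℕ) : ℝ) ^ (3 / 2 : ℝ) :=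
      (summable_nat_add_iff 1).2 (Real.summable_one_div_nat_rpow.2 (by norm_num))
    refine (h1.mul_left (√S ^ 3)).congr fun i => ?_
    have h2 : ((i + 1 : ℕ) : ℝ) ^ (3 / 2 : ℝ) = √((i : ℝ) + 1) ^ 3 := by
      rw [Real.sqrt_eq_rpow, ← Real.rpow_natCast, ← Real.rpow_mul (by positivity)]
      norm_num
    rw [h2, Real.sqrt_div' _ (by positivity), div_pow]
    ring
  have hle : ∀ i : ℕ, √(S / (i + 1)) ≤ √S := by
    intro i
    rw [Real.sqrt_div' _ (by positivity)]
    exact div_le_self (Real.sqrt_nonneg _)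
      (Real.one_le_sqrt.2 (by linarith [i.cast_nonneg (α := ℝ)]))
  have h := tendsto_tprod_one_add_of_dominated_convergence (𝓕 := atTop)
    (f := fun n i => (1 - x n i * z) * Complex.exp (x n i * z + (x n i * z) ^ 2 / 2) - 1)
    (g := fun i => (1 - y i * z) * Complex.exp (y i * z + (y i * z) ^ 2 / 2) - 1)
    (bound := fun i => √(S / (i + 1)) ^ 3 *
      (‖z‖ ^ 3 * Real.exp (√S * ‖z‖ + (√S * ‖z‖) ^ 2 / 2)))
    (hsum.mul_right _)
    (fun i => by
      have hc : Continuous fun t : ℝ =>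
          (1 - t * z) * Complex.exp (t * z + (t * z) ^ 2 / 2) - 1 := by fun_prop
      exact (hc.tendsto (y i)).comp (hlim i))
    (Eventually.of_forall fun n i => by
      refine (norm_one_sub_mul_exp_add_sq_sub_one_le _).trans ?_
      rw [norm_mul, Complex.norm_real, Real.norm_eq_abs, mul_pow, mul_assoc]
      have h1 := hx n i
      have h2 := h1.trans (hle i)
      gcongr)
  simpa using h

/-- The limit of real polynomials with boundedly many non-real zeros, at a centre where it does
not vanish: the exponent `α` is half the amount of `∑ x ^ 2` that is lost in the limit, so it is
nonnegative. -/
theorem exists_product_form_of_tendsto {f : ℕ → ℝ[X]} {a : ℕ → ℝ}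
    (hconv : ∀ k, Tendsto (fun n => (f n).coeff k) atTop (𝓝 (a k))) (ha : a 0 ≠ 0) {B : ℕ}
    (hB : ∀ n, (f n).natDegree ≤ (f n).roots.card + B) {G : ℂ → ℂ}
    (hG : ∀ z, Tendsto (fun n => ((f n).map (algebraMap ℝ ℂ)).eval z) atTop (𝓝 (G z))) :
    ∃ (P : ℝ[X]) (α β : ℝ) (x : ℕ → ℝ), 0 ≤ α ∧ Summable (fun i => x i ^ 2) ∧
      ∀ z, G z = Polynomial.aeval z P * Complex.exp (-α * z ^ 2 + β * z) *
        ∏' i, (1 - x i * z) * Complex.exp (x i * z) := by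
  obtain ⟨R, S, hR, hS, h⟩ := exists_factorization_of_tendsto hconv ha hB
  obtain ⟨N, hN⟩ := eventually_atTop.1 h
  choose! q s hf hdeg hq hs1 hs2 using hN
  choose x hx hx0 hxS using fun n => exists_enumeration (s n)
  -- All parameters of the factorization range over a compact metrizable space.
  let v : ℕ → (ℕ → ℝ) × (ℕ → ℝ) × ℝ × ℝ := fun n =>
    (x (n + N), fun k => (q (n + N)).coeff k, (s (n + N)).sum,
      ((s (n + N)).map fun y => y ^ 2).sum)
  have hxb : ∀ n i, N ≤ n → |x n i| ≤ √(S / (i + 1)) := by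
    intro n i hn
    refine Real.abs_le_sqrt ?_
    rw [le_div_iff₀ (by positivity), mul_comm]
    exact (hxS n i).trans (hs2 n hn)
  have hcpt : IsCompact ((Set.univ.pi fun i : ℕ => Set.Icc (-√(S / (i + 1))) √(S / (i + 1))) ×ˢ
      (Set.univ.pi fun _ : ℕ => Set.Icc (-(1 + R) ^ B) ((1 + R) ^ B)) ×ˢ
        Set.Icc (-S) S ×ˢ Set.Icc 0 S) :=
    (isCompact_univ_pi fun _ => isCompact_Icc).prod ((isCompact_univ_pi fun _ => isCompact_Icc).prod
      (isCompact_Icc.prod isCompact_Icc))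
  obtain ⟨⟨y, c, σ, τ⟩, -, idx, hidx, hlim⟩ := hcpt.tendsto_subseq (x := v) (fun n => by
    refine ⟨fun i _ => abs_le.1 (hxb _ i (by omega)), fun k _ => abs_le.1 ?_,
      abs_le.1 (hs1 _ (by omega)), Multiset.sum_nonneg fun w hw => ?_, hs2 _ (by omega)⟩
    · have h1 := norm_coeff_le_of_forall_norm_eval_le ((q (n + N)).map (algebraMap ℝ ℂ))
        one_pos (C := (1 + R) ^ B) (fun z hz => by simpa [hz] using hq (n + N) (by omega) z) k
      simpa using h1
    · obtain ⟨t, -, rfl⟩ := Multiset.mem_map.1 hw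
      positivity)
  have hidx_le : ∀ n, N ≤ idx n + N := fun n => by omega
  rw [nhds_prod_eq, nhds_prod_eq, nhds_prod_eq] at hlim
  have hy : ∀ i, Tendsto (fun n => x (idx n + N) i) atTop (𝓝 (y i)) :=
    tendsto_pi_nhds.1 hlim.fst
  have hc : ∀ k, Tendsto (fun n => (q (idx n + N)).coeff k) atTop (𝓝 (c k)) :=
    tendsto_pi_nhds.1 hlim.snd.fst
  have hσ : Tendsto (fun n => (s (idx n + N)).sum) atTop (𝓝 σ) := hlim.snd.snd.fst
  have hτ : Tendsto (fun n => ((s (idx n + N)).map fun y => y ^ 2).sum) atTop (𝓝 τ) :=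
    hlim.snd.snd.snd
  -- Fatou's lemma for the sums of squares.
  have hfatou : ∀ T : Finset ℕ, ∑ i ∈ T, y i ^ 2 ≤ τ := by
    intro T
    refine le_of_tendsto_of_tendsto' (tendsto_finsetSum T fun i _ => (hy i).pow 2) hτ fun n => ?_
    have h1 : ((s (idx n + N)).map fun y => y ^ 2).sum =
        ∑ i ∈ Finset.range (s (idx n + N)).card, x (idx n + N) i ^ 2 := by
      conv_lhs => rw [hx (idx n + N), Multiset.map_map]
      rfl
    rw [h1, ← Finset.sum_filter_add_sum_filter_not T (fun i => i < (s (idx n + N)).card)]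
    have h2 : ∑ i ∈ T.filter (fun i => ¬ i < (s (idx n + N)).card), x (idx n + N) i ^ 2 = 0 :=
      Finset.sum_eq_zero fun i hi => by
        rw [hx0 _ i (not_lt.1 (Finset.mem_filter.1 hi).2), zero_pow two_ne_zero]
    rw [h2, add_zero]
    exact Finset.sum_le_sum_of_subset_of_nonneg
      (fun i hi => Finset.mem_range.2 (Finset.mem_filter.1 hi).2) fun _ _ _ => sq_nonneg _
  have hysum : Summable fun i => y i ^ 2 :=
    summable_of_sum_le (fun _ => sq_nonneg _) hfatou
  have hyle : ∑' i, y i ^ 2 ≤ τ := hysum.tsum_le_of_sum_le hfatou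
  refine ⟨Polynomial.C (a 0) * ∑ k ∈ Finset.range (B + 1), Polynomial.C (c k) * Polynomial.X ^ k,
    (τ - ∑' i, y i ^ 2) / 2, -σ, y, by linarith, hysum, fun z => ?_⟩
  have hidx_lim : Tendsto (fun n => idx n + N) atTop atTop :=
    (tendsto_add_atTop_nat N).comp hidx.tendsto_atTop
  have hofReal : ∀ {u : ℕ → ℝ} {l : ℝ}, Tendsto u atTop (𝓝 l) →
      Tendsto (fun n => (u n : ℂ)) atTop (𝓝 l) := fun hu =>
    (Complex.continuous_ofReal.tendsto _).comp hu
  have hq' : Tendsto (fun n => ∑ k ∈ Finset.range (B + 1), ((q (idx n + N)).coeff k : ℂ) * z ^ k)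
      atTop (𝓝 (∑ k ∈ Finset.range (B + 1), (c k : ℂ) * z ^ k)) :=
    tendsto_finsetSum _ fun k _ => (hofReal (hc k)).mul_const _
  have he : Tendsto (fun n => Complex.exp (-((s (idx n + N)).sum : ℂ) * z -
      (((s (idx n + N)).map fun y => y ^ 2).sum : ℝ) / 2 * z ^ 2)) atTop
      (𝓝 (Complex.exp (-σ * z - τ / 2 * z ^ 2))) :=
    (Complex.continuous_exp.tendsto _).comp
      (((hofReal hσ).neg.mul_const z).sub (((hofReal hτ).div_const 2).mul_const (z ^ 2)))
  have hp := tendsto_tprod_genus_two (fun n i => hxb (idx n + N) i (hidx_le n)) hy z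
  have hall := ((hofReal ((hconv 0).comp hidx_lim)).mul hq').mul (he.mul hp)
  have huniq := tendsto_nhds_unique (((hG z).comp hidx_lim).congr fun n => ?_) hall
  · rw [huniq, tprod_genus_two hysum]
    have hP : Polynomial.aeval z (Polynomial.C (a 0) *
        ∑ k ∈ Finset.range (B + 1), Polynomial.C (c k) * Polynomial.X ^ k) =
        (a 0 : ℂ) * ∑ k ∈ Finset.range (B + 1), (c k : ℂ) * z ^ k := by
      simp
    have hE : Complex.exp (-σ * z - τ / 2 * z ^ 2) *
        Complex.exp ((∑' i, y i ^ 2 : ℝ) / 2 * z ^ 2) =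
        Complex.exp (-((τ - ∑' i, y i ^ 2) / 2 : ℝ) * z ^ 2 + (-σ : ℝ) * z) := by
      rw [← Complex.exp_add]
      congr 1
      push_cast
      ring
    rw [hP, ← hE]
    ring
  · have h1 := hf (idx n + N) (hidx_le n)
    simp only [Function.comp_apply]
    conv_lhs => rw [h1]
    rw [Polynomial.map_mul, Polynomial.map_mul, Polynomial.eval_mul, Polynomial.eval_mul,
      eval_recipProd_eq_tprod (hx _) (hx0 _), eval_map_eq_sum_range (hdeg _ (hidx_le n)),
      Polynomial.map_C, Polynomial.eval_C, mul_assoc, Complex.coe_algebraMap]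

/-- Translating a genus one product with real zeros. A factor `1 - x (z - t)` vanishing at `z = 0`
has `1 + x t = 0`; the finitely many such factors form the polynomial `P`. The other ones are
multiples of `1 - y z` with `y = x / (1 + x t)`, and that quotient is `0` by convention for the
exceptional factors. -/
lemma exists_translate_genus_one {x : ℕ → ℝ} (hx : Summable fun i => x i ^ 2) (t : ℝ) :
    ∃ (P : ℝ[X]) (κ δ : ℝ) (y : ℕ → ℝ), Summable (fun i => y i ^ 2) ∧
      ∀ z : ℂ, ∏' i, (1 - x i * (z - t)) * Complex.exp (x i * (z - t)) =
        Polynomial.aeval z P * κ * Complex.exp (δ * z) *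
          ∏' i, (1 - y i * z) * Complex.exp (y i * z) := by
  have hsmall : ∀ᶠ i in cofinite, |x i * t| ≤ 1 / 2 := by
    have h1 : Tendsto (fun i => (x i * t) ^ 2) cofinite (𝓝 0) := by
      simpa [mul_pow] using (hx.mul_right (t ^ 2)).tendsto_cofinite_zero
    filter_upwards [h1.eventually_lt_const (show (0 : ℝ) < (1 / 2) ^ 2 by norm_num)] with i hi
    exact (sq_lt_sq₀ (abs_nonneg _) (by norm_num)).1 (by rwa [sq_abs]) |>.le
  have hge : ∀ᶠ i in cofinite, 1 / 2 ≤ 1 + x i * t :=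
    hsmall.mono fun i hi => by linarith [neg_abs_le (x i * t)]
  have hT : {i | 1 + x i * t = 0}.Finite :=
    (eventually_cofinite.1 hge).subset fun i hi => by
      change ¬ 1 / 2 ≤ 1 + x i * t
      rw [show 1 + x i * t = 0 from hi]
      norm_num
  let y : ℕ → ℝ := fun i => x i / (1 + x i * t)
  have hyle : ∀ᶠ i in cofinite, |y i| ≤ 2 * |x i| := hge.mono fun i hi => by
    rw [abs_div, abs_of_pos (by linarith : 0 < 1 + x i * t), div_le_iff₀ (by linarith)]
    nlinarith [abs_nonneg (x i)]
  have hy : Summable fun i => y i ^ 2 := by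
    refine (hx.mul_left 4).of_norm_bounded_eventually (hyle.mono fun i hi => ?_)
    rw [Real.norm_of_nonneg (sq_nonneg _), ← sq_abs, ← sq_abs (x i)]
    nlinarith [abs_nonneg (y i)]
  have hδ : Summable fun i => x i - y i := by
    refine (hx.mul_left (2 * |t|)).of_norm_bounded_eventually ?_
    filter_upwards [hge, hyle] with i hi hyi
    -- The difference is of second order in `x i`.
    have h1 : x i - y i = x i * t * y i := by
      have : 1 + x i * t ≠ 0 := by linarith
      simp only [y]
      field_simp
      ring
    rw [h1, Real.norm_eq_abs, abs_mul, abs_mul, ← sq_abs (x i)]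
    nlinarith [abs_nonneg (x i), abs_nonneg t, mul_nonneg (abs_nonneg (x i)) (abs_nonneg t)]
  let κ : ℕ → ℝ := fun i => (if 1 + x i * t = 0 then 1 else 1 + x i * t) * Real.exp (-(x i * t))
  have hκ : Multipliable κ := by
    have h1 : Summable fun i => ‖κ i - 1‖ := by
      refine (hx.mul_left (t ^ 2 * Real.exp 1)).of_norm_bounded_eventually ?_
      filter_upwards [hge, hsmall] with i hi hs
      have h2 := norm_one_sub_mul_exp_sub_one_le ((-(x i * t) : ℝ) : ℂ)
      have h3 : (1 - ((-(x i * t) : ℝ) : ℂ)) * Complex.exp ((-(x i * t) : ℝ) : ℂ) - 1 =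
          ((κ i - 1 : ℝ) : ℂ) := by
        simp only [κ, if_neg (by linarith : ¬ 1 + x i * t = 0)]
        push_cast
        ring
      rw [h3, Complex.norm_real, Complex.norm_real, norm_neg, Real.norm_eq_abs (x i * t),
        sq_abs, mul_pow] at h2
      rw [norm_norm]
      refine h2.trans ?_
      have h4 : Real.exp |x i * t| ≤ Real.exp 1 := Real.exp_le_exp.2 (by linarith)
      calc x i ^ 2 * t ^ 2 * Real.exp |x i * t| ≤ x i ^ 2 * t ^ 2 * Real.exp 1 := by gcongr
        _ = _ := by ring
    simpa using multipliable_one_add_of_summable h1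
  refine ⟨∏ i ∈ hT.toFinset, Polynomial.C (-x i) * Polynomial.X, ∏' i, κ i, ∑' i, (x i - y i), y,
    hy, fun z => ?_⟩
  have hL : HasProd (fun i => if 1 + x i * t = 0 then -(x i : ℂ) * z else 1)
      (∏ i ∈ hT.toFinset, -(x i : ℂ) * z) := by
    have h1 := hasProd_prod_of_ne_finset_one (f := fun i =>
      if 1 + x i * t = 0 then -(x i : ℂ) * z else 1) (s := hT.toFinset)
      (L := SummationFilter.unconditional ℕ)
      (fun i hi => if_neg (by simpa using hi))
    convert h1 using 1
    exact Finset.prod_congr rfl fun i hi => (if_pos (by simpa using hi)).symm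
  have hκ' : HasProd (fun i => (κ i : ℂ)) ((∏' i, κ i : ℝ) : ℂ) :=
    hκ.hasProd.map Complex.ofRealHom Complex.continuous_ofReal
  have hδ' := ((Complex.hasSum_ofReal.2 hδ.hasSum).mul_right z).cexp
  have hprod := ((hL.mul hκ').mul hδ').mul (multipliable_genus_one hy z).hasProd
  have hP : Polynomial.aeval z (∏ i ∈ hT.toFinset, Polynomial.C (-x i) * Polynomial.X) =
      ∏ i ∈ hT.toFinset, -(x i : ℂ) * z := by
    simp [map_prod]
  rw [hP, ← hprod.tprod_eq]
  refine tprod_congr fun i => ?_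
  have hexp : Complex.exp (x i * (z - t)) =
      Complex.exp (-(x i * t)) * Complex.exp ((x i - y i) * z) * Complex.exp (y i * z) := by
    rw [← Complex.exp_add, ← Complex.exp_add]
    congr 1
    ring
  rw [hexp]
  by_cases hi : 1 + x i * t = 0
  · have hi' : 1 + (x i : ℂ) * t = 0 := by exact_mod_cast hi
    have hy0 : y i = 0 := by simp only [y, hi, div_zero]
    simp only [κ, if_pos hi, hy0, Function.comp_apply]
    push_cast
    linear_combination (Complex.exp (-(x i * t)) * Complex.exp ((x i - 0) * z) *
      Complex.exp (0 * z)) * hi'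
  · have hi' : 1 + (x i : ℂ) * t ≠ 0 := by exact_mod_cast hi
    have hyx : (1 + (x i : ℂ) * t) * y i = x i := by
      simp only [y]
      push_cast
      field_simp
    simp only [κ, if_neg hi, Function.comp_apply]
    push_cast
    linear_combination (Complex.exp (-(x i * t)) * Complex.exp ((x i - y i) * z) *
      Complex.exp (y i * z)) * z * hyx

/-- Entries equal to zero contribute trivial factors, so a genus one product over a square summable
sequence of reals belongs to the Laguerre–Pólya class. -/
lemma isLaguerrePolya_of_product_form {x : ℕ → ℝ} (hx : Summable fun i => x i ^ 2) (c : ℝ) {α : ℝ}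
    (hα : 0 ≤ α) (β : ℝ) :
    IsLaguerrePolya fun z => c * Complex.exp (-α * z ^ 2 + β * z) *
      ∏' i, (1 - x i * z) * Complex.exp (x i * z) := by
  refine ⟨c, 0, α, β, {i | x i ≠ 0}, fun j => (x j)⁻¹, hα, fun j => inv_ne_zero j.2, ?_,
    fun z => ?_⟩
  · refine (hx.comp_injective (i := ((↑) : {i | x i ≠ 0} → ℕ)) Subtype.val_injective).congr
      fun j => ?_
    simp
  · have h1 : (fun j : {i | x i ≠ 0} => (1 - z / (((x j)⁻¹ : ℝ) : ℂ)) *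
        Complex.exp (z / (((x j)⁻¹ : ℝ) : ℂ))) =
        (fun i => (1 - x i * z) * Complex.exp (x i * z)) ∘ ((↑) : {i | x i ≠ 0} → ℕ) := by
      ext j
      simp [mul_comm]
    have h2 : Function.mulSupport (fun i => (1 - x i * z) * Complex.exp (x i * z)) ⊆
        {i | x i ≠ 0} := by
      intro i hi h0
      exact hi (by simp [h0])
    have h3 := (hasProd_subtype_iff_of_mulSupport_subset h2).2 (multipliable_genus_one hx z).hasProd
    rw [h1]
    exact ⟨h3.multipliable, by rw [h3.tprod_eq]; ring⟩

theorem theorem1p2 (f : ℕ → ℝ[X]) (s : PowerSeries ℂ)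
    (hweak : ConvergesWeakly (fun n => (f n).map (algebraMap ℝ ℂ)) s)
    (hne : ∃ k : ℕ, PowerSeries.coeff k s ≠ 0)
    (hbdd : ∃ B : ℕ, ∀ n : ℕ,
      zeroCount ((f n).map (algebraMap ℝ ℂ)) {z : ℂ | z.im ≠ 0} ≤ B) :
    ∃ F : ℂ → ℂ, Represents s F ∧ IsLaguerrePolyaStar F ∧
      ConvergesStrongly (fun n => (f n).map (algebraMap ℝ ℂ)) F := by
  obtain ⟨B, hB⟩ := hbdd
  have hB' := fun n => natDegree_le_card_roots_add (hB n)
  have hcoeff : ∀ k, ∃ a : ℝ, Tendsto (fun n => (f n).coeff k) atTop (𝓝 a) ∧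
      PowerSeries.coeff k s = a := by
    intro k
    obtain ⟨l, hl, hs⟩ := hweak k
    have h1 : Tendsto (fun n => (((f n).coeff k : ℝ) : ℂ)) atTop (𝓝 (PowerSeries.coeff k s)) := by
      rw [hs]
      refine (hl.const_mul (1 / (k ! : ℂ))).congr fun n => ?_
      rw [← Polynomial.coeff_zero_eq_eval_zero, Polynomial.coeff_iterate_derivative, zero_add,
        Nat.descFactorial_self, nsmul_eq_mul, ← mul_assoc, one_div,
        inv_mul_cancel₀ (by exact_mod_cast Nat.factorial_ne_zero k), one_mul, Polynomial.coeff_map,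
        Complex.coe_algebraMap]
    have h2 := (Complex.continuous_re.tendsto _).comp h1
    have h3 : Tendsto (fun n => (f n).coeff k) atTop (𝓝 (PowerSeries.coeff k s).re) := h2
    exact ⟨_, h3, tendsto_nhds_unique h1 ((Complex.continuous_ofReal.tendsto _).comp h3)⟩
  choose a hconv hsa using hcoeff
  obtain ⟨K, hK⟩ := hne
  have haK : a K ≠ 0 := fun h => hK (by rw [hsa, h, Complex.ofReal_zero])
  have hC := fun (r : ℝ) (hr : 0 < r) => exists_coeff_bound hconv haK hB' hr
  have hsum := summable_of_coeff_bound hconv hC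
  have hstrong := convergesStrongly_of_coeff_bound hconv hC
  set F : ℂ → ℂ := fun z => ∑' k, (a k : ℂ) * z ^ k with hF
  have hFreal : ∀ x : ℝ, F x = ((∑' k, a k * x ^ k : ℝ) : ℂ) := fun x => by
    rw [hF, Complex.ofReal_tsum]
    push_cast
    rfl
  have hFdiff : Differentiable ℂ F := by
    have h1 : TendstoLocallyUniformlyOn (fun n z => ((f n).map (algebraMap ℝ ℂ)).eval z) F atTop
        Set.univ :=
      (tendstoLocallyUniformlyOn_iff_forall_isCompact isOpen_univ).2 fun K _ hK => hstrong K hK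
    exact differentiableOn_univ.1 (h1.differentiableOn
      (Eventually.of_forall fun n => (Polynomial.differentiable _).differentiableOn) isOpen_univ)
  have hpt : ∀ z, Tendsto (fun n => ((f n).map (algebraMap ℝ ℂ)).eval z) atTop (𝓝 (F z)) :=
    fun z => (hstrong {z} isCompact_singleton).tendsto_at rfl
  refine ⟨F, fun z => ?_, ⟨⟨hFdiff, fun x => by rw [hFreal, Complex.ofReal_im]⟩, ?_⟩, hstrong⟩
  · simp only [hsa]
    exact (hsum z).hasSum
  -- The zeros are studied relative to a real centre where the limit does not vanish.
  obtain ⟨t, ht⟩ := exists_tsum_ne_zero (fun x => by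
    have := hsum (x : ℂ)
    exact_mod_cast this) haK
  obtain ⟨P, α, β, x, hα, hx, hG⟩ := exists_product_form_of_tendsto
    (f := fun n => Polynomial.taylor t (f n)) (G := fun z => F (z + t))
    (exists_tendsto_coeff_taylor hconv hC t) (by simpa using ht)
    (fun n => natDegree_taylor_le (hB' n) t) (fun z => by
      simpa [Polynomial.map_taylor, Polynomial.taylor_eval] using hpt (z + t))
  obtain ⟨Q, κ, δ, y, hy, hxy⟩ := exists_translate_genus_one hx t
  refine ⟨P.comp (Polynomial.X - Polynomial.C t) * Q, _, isLaguerrePolya_of_product_form hy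
    (κ * Real.exp (-α * t ^ 2 - β * t)) hα (2 * α * t + β + δ), fun z => ?_⟩
  have h1 := hG (z - t)
  rw [sub_add_cancel] at h1
  rw [h1, hxy]
  have h2 : Complex.exp (-α * (z - t) ^ 2 + β * (z - t)) * Complex.exp (δ * z) =
      (Real.exp (-α * t ^ 2 - β * t) : ℂ) *
        Complex.exp (-α * z ^ 2 + (2 * α * t + β + δ : ℝ) * z) := by
    push_cast
    rw [← Complex.exp_add, ← Complex.exp_add]
    congr 1
    ring
  have h3 : Polynomial.aeval z (P.comp (Polynomial.X - Polynomial.C t)) =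
      Polynomial.aeval (z - t) P := by
    simp [Polynomial.aeval_comp]
  rw [map_mul, h3]
  push_cast at h2 ⊢
  linear_combination (Polynomial.aeval (z - t) P * Polynomial.aeval z Q * κ *
    ∏' i, (1 - (y i : ℂ) * z) * Complex.exp (y i * z)) * h2
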